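/- Let $\hbar>0$ and let $\mu_A,\mu_B$ be probability measures on $\mathbb R$ (momentum-kick distributions), with dephasing functions $g_j(\xi)=\int e^{ip\xi/\hbar}\,d\mu_j(p)$, $j\in\{A,B\}$. Let $X$ be the position operator (multiplication by $x$) on $L^2(\mathbb R)$. A state on a Hilbert space is a positive trace-class operator of trace one. For a state $\rho$ on $L^2(\mathbb R)$ put $$\Delta_{g_j}(\rho)=\int e^{ipX/\hbar}\,\rho\,e^{-ipX/\hbar}\,d\mu_j(p),$$ (so the kernel $\rho(x,y)$ is mapped to $g_j(x-y)\rho(x,y)$), and for a state $\rho$ on $L^2(\mathbb R)\otimes L^2(\mathbb R)$ put $$(\Delta_{g_A}\otimes\Delta_{g_B})(\rho)=\iint \big(e^{ipX/\hbar}\otimes e^{iqX/\hbar}\big)\,\rho\,\big(e^{-ipX/\hbar}\otimes e^{-iqX/\hbar}\big)\,d\mu_A(p)\,d\mu_B(q).$$ For states $\rho,\sigma$ let $S(\rho\Vert\sigma)=\operatorname{Tr}\rho(\ln\rho-\ln\sigma)\in[0,\infty]$ be the quantum relative entropy, defined in general from the spectral decompositions $\rho=\sum_p pP_p$, $\sigma=\sum_q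 qQ_q$ by $S(\rho\Vert\sigma)=\sum_{p,q}\operatorname{Tr}(P_pQ_qP_p)\,(p\ln p-p\ln q+q-p)$, where the scalar factor is $q$ if $p=0$ and $\infty$ if $p>0=q$, and $0\cdot\infty=0$. Define the relative-entropy and Hilbert--Schmidt losses $$C_{\rm rel}^{g_j}(\rho)=S(\rho\Vert\Delta_{g_j}(\rho)),\qquad C_2^{g_j}(\rho)=\operatorname{Tr}(\rho^2)-\operatorname{Tr}(\Delta_{g_j}(\rho)^2),$$ and $C_{\rm rel}^{g_A,g_B}$, $C_2^{g_A,g_B}$ in the same way with $\Delta_{g_A}\otimes\Delta_{g_B}$ in place of $\Delta_{g_j}$. (1) For all states $\rho_A,\rho_B$ on $L^2(\mathbb R)$: $\rho_A\otimes\rho_B$, $\Delta_{g_A}(\rho_A)$ and $\Delta_{g_B}(\rho_B)$ are states, $(\Delta_{g_A}\otimes\Delta_{g_B})(\rho_A\otimes\rho_B)=\Delta_{g_A}(\rho_A)\otimes\Delta_{g_B}(\rho_B)$, the relative-entropy loss is additive, $$C_{\rm rel}^{g_A,g_B}(\rho_A\otimes\rho_B)=C_{\rm rel}^{g_A}(\rho_A)+C_{\rm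 rel}^{g_B}(\rho_B)\quad\text{in }[0,\infty]$$ (in particular the left side is finite if and only if both terms on the right are), and $$C_2^{g_A,g_B}(\rho_A\otimes\rho_B)=\operatorname{Tr}(\rho_A^2)\operatorname{Tr}(\rho_B^2)-\operatorname{Tr}\big(\Delta_{g_A}(\rho_A)^2\big)\operatorname{Tr}\big(\Delta_{g_B}(\rho_B)^2\big).$$ (2) The Hilbert--Schmidt loss is not additive: if $|g_A(\xi)|<1$ for some $\xi$ and $|g_B(\xi)|<1$ for some $\xi$, then there are states $\rho_A,\rho_B$ on $L^2(\mathbb R)$ with $C_2^{g_A,g_B}(\rho_A\otimes\rho_B)\neq C_2^{g_A}(\rho_A)+C_2^{g_B}(\rho_B)$. -/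

import Mathlib

open MeasureTheory Complex
open scoped ENNReal NNReal TensorProduct InnerProductSpace

noncomputable section

namespace Dephasing

section Hilbert

variable {H : Type*} [NormedAddCommGroup H] [InnerProductSpace ℂ H] [CompleteSpace H]

/-- The trace `∑ᵢ ⟪eᵢ, T eᵢ⟫ ∈ [0, ∞]` of a positive bounded operator, computed in a Hilbert basis.
By `posTrace_eq_tsum` it does not depend on the basis. -/
def posTrace (T : H →L[ℂ] H) : ℝ≥0∞ :=
  ∑' i, ENNReal.ofReal
    (⟪(exists_hilbertBasis ℂ H).choose_spec.choose i,
      T ((exists_hilbertBasis ℂ H).choose_spec.choose i)⟫_ℂ).re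

theorem tsum_inner_sq_eq {ι : Type*} (b : HilbertBasis ι ℂ H) (x : H) :
    ∑' i, ENNReal.ofReal (‖⟪b i, x⟫_ℂ‖ ^ 2) = ENNReal.ofReal (‖x‖ ^ 2) := by
  have h := b.hasSum_inner_mul_inner x x
  have h2 : HasSum (fun i => ‖⟪b i, x⟫_ℂ‖ ^ 2) (‖x‖ ^ 2) := by
    have h3 := (Complex.hasSum_re h)
    convert h3 using 1
    · funext i
      rw [← inner_conj_symm x (b i), ← Complex.normSq_eq_conj_mul_self, Complex.ofReal_re,
        Complex.normSq_eq_norm_sq]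
    · exact (inner_self_eq_norm_sq (𝕜 := ℂ) x).symm
  rw [← ENNReal.ofReal_tsum_of_nonneg (fun i => by positivity) h2.summable, h2.tsum_eq]

theorem tsum_norm_sq_adjoint {ι κ : Type*} (b : HilbertBasis ι ℂ H) (c : HilbertBasis κ ℂ H)
    (S : H →L[ℂ] H) :
    ∑' i, ENNReal.ofReal (‖S (b i)‖ ^ 2)
      = ∑' j, ENNReal.ofReal (‖ContinuousLinearMap.adjoint S (c j)‖ ^ 2) :=
  calc _ = ∑' i, ∑' j, ENNReal.ofReal (‖⟪c j, S (b i)⟫_ℂ‖ ^ 2) := by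
        simp_rw [tsum_inner_sq_eq c]
    _ = ∑' j, ∑' i, ENNReal.ofReal (‖⟪c j, S (b i)⟫_ℂ‖ ^ 2) := ENNReal.tsum_comm
    _ = _ := by
        refine tsum_congr fun j => ?_
        rw [← tsum_inner_sq_eq b]
        refine tsum_congr fun i => ?_
        rw [ContinuousLinearMap.adjoint_inner_right, norm_inner_symm]

theorem tsum_posTrace_aux {ι κ : Type*} (b : HilbertBasis ι ℂ H) (c : HilbertBasis κ ℂ H)
    {T : H →L[ℂ] H} (hT : T.IsPositive) :
    ∑' i, ENNReal.ofReal (⟪b i, T (b i)⟫_ℂ).re = ∑' j, ENNReal.ofReal (⟪c j, T (c j)⟫_ℂ).re := by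
  obtain ⟨S, rfl⟩ := CStarAlgebra.nonneg_iff_eq_star_mul_self.mp
    ((ContinuousLinearMap.nonneg_iff_isPositive T).mpr hT)
  have key : ∀ x : H, (⟪x, (star S * S) x⟫_ℂ).re = ‖S x‖ ^ 2 := fun x => by
    rw [ContinuousLinearMap.star_eq_adjoint, mul_apply_eq_comp,
      ContinuousLinearMap.adjoint_inner_right]
    exact inner_self_eq_norm_sq (𝕜 := ℂ) (S x)
  simp_rw [key]
  rw [tsum_norm_sq_adjoint b c S, tsum_norm_sq_adjoint c c S]

/-- The trace of a positive operator may be computed in any Hilbert basis. -/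
theorem posTrace_eq_tsum {ι : Type*} (b : HilbertBasis ι ℂ H) {T : H →L[ℂ] H}
    (hT : T.IsPositive) :
    posTrace T = ∑' i, ENNReal.ofReal (⟪b i, T (b i)⟫_ℂ).re :=
  tsum_posTrace_aux _ b hT

/-- A (normal) state: a positive trace-class operator of trace one. -/
structure IsDensityOperator (ρ : H →L[ℂ] H) : Prop where
  isPositive : ρ.IsPositive
  posTrace_eq_one : posTrace ρ = 1

/-- `Tr(T²)` for a self-adjoint operator `T`; finite when `T` is a state. -/
def purity (T : H →L[ℂ] H) : ℝ := (posTrace (T * T)).toReal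

/-- The orthogonal projection onto the eigenspace of `T` for the real number `a`
(zero if `a` is not an eigenvalue). -/
def eigenProj (T : H →L[ℂ] H) (a : ℝ≥0) : H →L[ℂ] H :=
  (T - ((a : ℝ) : ℂ) • (1 : H →L[ℂ] H)).ker.starProjection

/-- The scalar function `p log p - p log q + q - p ∈ [0, ∞]`, with its usual values
`q` at `p = 0` and `∞` at `p > 0 = q`. -/
def scalarRelEntropy (p q : ℝ≥0) : ℝ≥0∞ :=
  if p = 0 then q
  else if q = 0 then ∞
  else ENNReal.ofReal (p * Real.log p - p * Real.log q + q - p)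

/-- Umegaki's quantum relative entropy `S(ρ‖σ) = Tr ρ (log ρ - log σ) ∈ [0, ∞]` of two states on a
Hilbert space of arbitrary dimension, in Lindblad's form: with the spectral decompositions
`ρ = ∑ p P_p` and `σ = ∑ q Q_q`,
`S(ρ‖σ) = ∑_{p,q} Tr(P_p Q_q P_p) (p log p - p log q + q - p)`.
All terms are nonnegative, the terms `q - p` add up to `Tr σ - Tr ρ = 0`, and the value is `∞` as
soon as the support of `ρ` is not contained in that of `σ`. -/
def relEntropy (ρ σ : H →L[ℂ] H) : ℝ≥0∞ :=
  ∑' (p : ℝ≥0) (q : ℝ≥0),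
    posTrace (eigenProj ρ p * eigenProj σ q * eigenProj ρ p) * scalarRelEntropy p q

end Hilbert

section Tensor

variable (H K : Type*) [NormedAddCommGroup H] [InnerProductSpace ℂ H]
  [NormedAddCommGroup K] [InnerProductSpace ℂ K]

/-- The Hilbert space tensor product: the completion of the algebraic tensor product for the inner
product `⟪x ⊗ y, x' ⊗ y'⟫ = ⟪x, x'⟫ ⟪y, y'⟫`. -/
abbrev HilbertTensor : Type _ := UniformSpace.Completion (H ⊗[ℂ] K)

variable {H K}

/-- The bounded operator `A ⊗ B` on the Hilbert space tensor product. -/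
def opTensor (A : H →L[ℂ] H) (B : K →L[ℂ] K) : HilbertTensor H K →L[ℂ] HilbertTensor H K :=
  (TensorProduct.mapL A B).completion

theorem opTensor_tmul (A : H →L[ℂ] H) (B : K →L[ℂ] K) (x : H) (y : K) :
    opTensor A B ((x ⊗ₜ[ℂ] y : H ⊗[ℂ] K) : HilbertTensor H K)
      = ((A x ⊗ₜ[ℂ] B y : H ⊗[ℂ] K) : HilbertTensor H K) := by
  simp [opTensor]

end Tensor

/-- The Hilbert space `L²(ℝ)` of a particle on the line, in the position representation. -/
abbrev L2R : Type := Lp ℂ 2 (volume : Measure ℝ)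

/-- The phase `x ↦ e^{i p x / ħ}`. -/
def phase (ħ p : ℝ) (x : ℝ) : ℂ := Complex.exp (Complex.I * (p * x / ħ : ℝ))

theorem norm_phase (ħ p x : ℝ) : ‖phase ħ p x‖ = 1 := by
  rw [phase, mul_comm]; exact Complex.norm_exp_ofReal_mul_I _

theorem continuous_phase (ħ p : ℝ) : Continuous (phase ħ p) := by
  unfold phase; fun_prop

theorem memLp_phase (ħ p : ℝ) : MemLp (phase ħ p) ∞ (volume : Measure ℝ) :=
  memLp_top_of_bound (continuous_phase ħ p).aestronglyMeasurable 1
    (Filter.Eventually.of_forall fun x => (norm_phase ħ p x).le)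

/-- The momentum kick `e^{i p X / ħ}` on `L²(ℝ)`: multiplication by `x ↦ e^{i p x / ħ}`. -/
def kick (ħ p : ℝ) : L2R →L[ℂ] L2R :=
  (ContinuousLinearMap.mul ℂ ℂ).holderL (volume : Measure ℝ) ∞ 2 2 (memLp_phase ħ p).toLp

theorem coeFn_kick (ħ p : ℝ) (ψ : L2R) :
    (kick ħ p ψ : ℝ → ℂ) =ᵐ[volume] fun x => phase ħ p x * ψ x := by
  have h := (ContinuousLinearMap.mul ℂ ℂ).coeFn_holder (r := 2) ((memLp_phase ħ p).toLp) ψ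
  filter_upwards [h, (memLp_phase ħ p).coeFn_toLp] with x hx hx'
  rw [← hx', ← ContinuousLinearMap.mul_apply' ℂ ℂ, ← hx]
  rfl

/-- The dephasing function `g(ξ) = ∫ e^{i p ξ / ħ} dμ(p)`, the characteristic function of the kick
distribution `μ`. -/
def dephasingFun (ħ : ℝ) (μ : Measure ℝ) (ξ : ℝ) : ℂ := ∫ p, phase ħ p ξ ∂μ

/-- The random momentum kick (position dephasing) channel
`Δ_g(ρ) = ∫ e^{i p X / ħ} ρ e^{-i p X / ħ} dμ(p)`, for `ρ` trace class (so that the integrand is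
norm continuous); on kernels it multiplies `ρ(x, y)` by `g(x - y)`. -/
def dephase (ħ : ℝ) (μ : Measure ℝ) (ρ : L2R →L[ℂ] L2R) : L2R →L[ℂ] L2R :=
  ∫ p, kick ħ p * ρ * kick ħ (-p) ∂μ

/-- The product channel `Δ_{g_A} ⊗ Δ_{g_B}` on `L²(ℝ) ⊗ L²(ℝ)`: independent random momentum kicks
of the two particles, with distributions `μA` and `μB`. -/
def dephaseProd (ħ : ℝ) (μA μB : Measure ℝ)
    (ρ : HilbertTensor L2R L2R →L[ℂ] HilbertTensor L2R L2R) :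
    HilbertTensor L2R L2R →L[ℂ] HilbertTensor L2R L2R :=
  ∫ pq : ℝ × ℝ, opTensor (kick ħ pq.1) (kick ħ pq.2) * ρ *
    opTensor (kick ħ (-pq.1)) (kick ħ (-pq.2)) ∂(μA.prod μB)

/-- The relative-entropy loss `S(ρ‖Δ(ρ)) ∈ [0, ∞]` of a map `Δ` on operators. -/
def relEntropyLoss {H : Type*} [NormedAddCommGroup H] [InnerProductSpace ℂ H] [CompleteSpace H]
    (Δ : (H →L[ℂ] H) → (H →L[ℂ] H)) (ρ : H →L[ℂ] H) : ℝ≥0∞ :=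
  relEntropy ρ (Δ ρ)

/-- The Hilbert-Schmidt loss `Tr(ρ²) - Tr(Δ(ρ)²)` of a map `Δ` on operators. -/
def hilbertSchmidtLoss {H : Type*} [NormedAddCommGroup H] [InnerProductSpace ℂ H]
    [CompleteSpace H] (Δ : (H →L[ℂ] H) → (H →L[ℂ] H)) (ρ : H →L[ℂ] H) : ℝ :=
  purity ρ - purity (Δ ρ)

end Dephasing

end

open Dephasing

/-!
If `ρ` and `σ` have eigenbases `e` and `f` with eigenvalues `p` and `q`, then
`S(ρ‖σ) = ∑ᵢⱼ |⟪eᵢ, fⱼ⟫|² s(pᵢ, qⱼ)`, where `s` is the scalar relative entropy.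
Under tensor products of operators the eigenbases are tensored, while eigenvalues and transition
probabilities multiply. Additivity thus reduces to the identity
`s(p p', q q') + p' q + p q' = p' s(p, q) + p s(p', q') + q q' + p p'`,
whose correction terms sum to `2` on either side because all traces are one.

A dephased pure state is a mixture of the kicked states `e^{ipX/ħ} ψ`. It is pure only if almost all
of these agree up to a phase factor. If `ψ` has no zeros, then `p ↦ e^{ipx/ħ}` is almost everywhere
constant for each `x`, so that `|g| = 1` everywhere. Otherwise `a = Tr Δ(|ψ⟩⟨ψ|)²` differs from `1`,
and `1 - a b ≠ (1 - a) + (1 - b)` when `a, b ≠ 1`.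
-/

noncomputable section

namespace Dephasing

section RankOneSums

variable {𝕜 E F : Type*} [RCLike 𝕜] [NormedAddCommGroup E] [InnerProductSpace 𝕜 E]
  [NormedAddCommGroup F] [InnerProductSpace 𝕜 F]

theorem norm_sum_rankOne_le {ι : Type*} {v : ι → E} (hv : Orthonormal 𝕜 v) (w : ι → F)
    (s : Finset ι) :
    ‖∑ i ∈ s, InnerProductSpace.rankOne 𝕜 (w i) (v i)‖ ≤ √(∑ i ∈ s, ‖w i‖ ^ 2) := by
  refine ContinuousLinearMap.opNorm_le_bound _ (Real.sqrt_nonneg _) fun x => ?_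
  simp only [sum_apply, InnerProductSpace.rankOne_apply]
  calc ‖∑ i ∈ s, ⟪v i, x⟫_𝕜 • w i‖ ≤ ∑ i ∈ s, ‖⟪v i, x⟫_𝕜‖ * ‖w i‖ :=
        (norm_sum_le _ _).trans_eq (Finset.sum_congr rfl fun i _ => norm_smul _ _)
    _ ≤ √(∑ i ∈ s, ‖⟪v i, x⟫_𝕜‖ ^ 2) * √(∑ i ∈ s, ‖w i‖ ^ 2) :=
        Real.sum_mul_le_sqrt_mul_sqrt _ _ _
    _ ≤ ‖x‖ * √(∑ i ∈ s, ‖w i‖ ^ 2) := by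
        gcongr
        exact Real.sqrt_le_iff.mpr ⟨norm_nonneg x, hv.sum_inner_products_le x⟩
    _ = √(∑ i ∈ s, ‖w i‖ ^ 2) * ‖x‖ := mul_comm _ _

theorem summable_rankOne [CompleteSpace F] {ι : Type*} {v : ι → E} (hv : Orthonormal 𝕜 v)
    {w : ι → F} (hw : Summable fun i => ‖w i‖ ^ 2) :
    Summable fun i => InnerProductSpace.rankOne 𝕜 (w i) (v i) := by
  rw [summable_iff_vanishing_norm] at hw ⊢
  intro ε hε
  obtain ⟨s, hs⟩ := hw (ε ^ 2) (by positivity)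
  refine ⟨s, fun t ht => (norm_sum_rankOne_le hv w t).trans_lt ?_⟩
  rw [Real.sqrt_lt' hε]
  exact (le_abs_self _).trans_lt (hs t ht)

theorem hasSum_rankOne_apply_hilbertBasis [CompleteSpace F] {ι : Type*} (b : HilbertBasis ι 𝕜 E)
    {T : E →L[𝕜] F} (hT : Summable fun i => ‖T (b i)‖ ^ 2) :
    HasSum (fun i => InnerProductSpace.rankOne 𝕜 (T (b i)) (b i)) T := by
  have hsum := summable_rankOne b.orthonormal hT
  suffices h : ∑' i, InnerProductSpace.rankOne 𝕜 (T (b i)) (b i) = T by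
    simpa only [h] using hsum.hasSum
  ext x
  have h₁ := hsum.hasSum.mapL (ContinuousLinearMap.apply 𝕜 F x)
  have h₂ := (b.hasSum_repr x).mapL T
  simp only [ContinuousLinearMap.apply_apply, InnerProductSpace.rankOne_apply] at h₁
  simp only [map_smul, b.repr_apply_apply] at h₂
  exact h₁.unique h₂

theorem isCompactOperator_rankOne (x : F) (y : E) :
    IsCompactOperator (InnerProductSpace.rankOne 𝕜 x y) :=
  (isCompactOperator_of_locallyCompactSpace_dom (innerSL 𝕜 y)).clm_comp
    (ContinuousLinearMap.toSpanSingleton 𝕜 x)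

end RankOneSums

section HilbertBasis

variable {𝕜 E : Type*} [RCLike 𝕜] [NormedAddCommGroup E] [InnerProductSpace 𝕜 E]

theorem continuousLinearMap_ext_hilbertBasis {F : Type*} [NormedAddCommGroup F] [NormedSpace 𝕜 F]
    {ι : Type*} (b : HilbertBasis ι 𝕜 E) {S T : E →L[𝕜] F} (h : ∀ i, S (b i) = T (b i)) :
    S = T :=
  ContinuousLinearMap.ext_on (Submodule.dense_iff_topologicalClosure_eq_top.mpr b.dense_span)
    (Set.forall_mem_range.mpr h)

theorem countable_of_hilbertBasis [TopologicalSpace.SeparableSpace E] {ι : Type*}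
    (b : HilbertBasis ι 𝕜 E) : Countable ι := by
  refine Pairwise.countable_of_isOpen_disjoint (s := fun i => Metric.ball (b i) (1 / 2))
    (fun i j hij => Metric.ball_disjoint_ball ?_) (fun i => Metric.isOpen_ball)
    fun i => ⟨b i, Metric.mem_ball_self (by norm_num)⟩
  have h := norm_sub_sq (𝕜 := 𝕜) (b i) (b j)
  rw [b.orthonormal.2 hij, b.orthonormal.1, b.orthonormal.1, map_zero] at h
  rw [dist_eq_norm]
  nlinarith [norm_nonneg (b i - b j)]

theorem mem_orthogonal_of_forall_inner_hilbertBasis_eq_zero {K : Submodule 𝕜 E}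
    [K.HasOrthogonalProjection] {ι : Type*} (b : HilbertBasis ι 𝕜 K) {x : E}
    (hx : ∀ i, ⟪(b i : E), x⟫_𝕜 = 0) : x ∈ Kᗮ := by
  rw [← Submodule.orthogonalProjectionOnto_eq_zero_iff]
  apply b.repr.injective
  ext i
  rw [b.repr_apply_apply, Submodule.inner_orthogonalProjectionOnto_eq_of_mem_left, hx, map_zero]
  rfl

theorem exists_hilbertBasis_of_orthogonalFamily.{u, v} {E : Type u} [NormedAddCommGroup E]
    [InnerProductSpace 𝕜 E] [CompleteSpace E] {κ : Type v} {K : κ → Submodule 𝕜 E}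
    [∀ k, CompleteSpace (K k)]
    (hK : OrthogonalFamily 𝕜 (fun k => K k) fun k => (K k).subtypeₗᵢ) (hbot : (⨆ k, K k)ᗮ = ⊥) :
    ∃ (ι : Type (max u v)) (b : HilbertBasis ι 𝕜 E), ∀ i, ∃ k, b i ∈ K k := by
  choose w b _ using fun k => exists_hilbertBasis 𝕜 (K k)
  have hv := hK.orthonormal_sigma_orthonormal fun k => (b k).orthonormal
  have hspan : (Submodule.span 𝕜
      (Set.range fun a : (k : κ) × w k => (K a.1).subtypeₗᵢ (b a.1 a.2)))ᗮ = ⊥ := by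
    rw [eq_bot_iff, ← hbot, ← Submodule.iInf_orthogonal]
    refine le_iInf fun k x hx =>
      mem_orthogonal_of_forall_inner_hilbertBasis_eq_zero (b k) fun i => ?_
    exact (Submodule.mem_orthogonal _ x).mp hx _ (Submodule.subset_span ⟨⟨k, i⟩, rfl⟩)
  refine ⟨(k : κ) × w k, HilbertBasis.mkOfOrthogonalEqBot hv hspan, fun a => ⟨a.1, ?_⟩⟩
  rw [HilbertBasis.coe_mkOfOrthogonalEqBot]
  exact (b a.1 a.2).2

end HilbertBasis

section Trace

open scoped ComplexOrder in
theorem isPositive_of_forall_inner_nonneg {H : Type*} [NormedAddCommGroup H]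
    [InnerProductSpace ℂ H] {T : H →L[ℂ] H} (hT : ∀ x, 0 ≤ ⟪x, T x⟫_ℂ) : T.IsPositive := by
  rw [ContinuousLinearMap.isPositive_iff_complex]
  intro x
  obtain ⟨hre, him⟩ := Complex.nonneg_iff.mp (hT x)
  rw [← inner_conj_symm, RCLike.re_eq_complex_re, Complex.conj_re]
  exact ⟨by rw [Complex.conj_eq_iff_im.mpr him.symm]; exact Complex.ext rfl him, hre⟩

variable {H : Type*} [NormedAddCommGroup H] [InnerProductSpace ℂ H] [CompleteSpace H]

theorem isPositive_star_mul_self (S : H →L[ℂ] H) : (star S * S).IsPositive :=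
  ContinuousLinearMap.isPositive_adjoint_comp_self S

theorem exists_eq_star_mul_self {T : H →L[ℂ] H} (hT : T.IsPositive) :
    ∃ S : H →L[ℂ] H, T = star S * S :=
  CStarAlgebra.nonneg_iff_eq_star_mul_self.mp
    ((ContinuousLinearMap.nonneg_iff_isPositive T).mpr hT)

theorem posTrace_star_mul_self_eq_tsum {ι : Type*} (b : HilbertBasis ι ℂ H) (S : H →L[ℂ] H) :
    posTrace (star S * S) = ∑' i, ENNReal.ofReal (‖S (b i)‖ ^ 2) := by
  rw [posTrace_eq_tsum b (isPositive_star_mul_self S)]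
  refine tsum_congr fun i => ?_
  rw [ContinuousLinearMap.star_eq_adjoint, mul_apply_eq_comp,
    ContinuousLinearMap.adjoint_inner_right]
  exact congrArg _ (inner_self_eq_norm_sq (𝕜 := ℂ) _)

theorem posTrace_star_mul_self_comm (S : H →L[ℂ] H) :
    posTrace (star S * S) = posTrace (S * star S) := by
  obtain ⟨_, b, _⟩ := exists_hilbertBasis ℂ H
  have h := posTrace_star_mul_self_eq_tsum b (star S)
  rw [star_star] at h
  rw [h, posTrace_star_mul_self_eq_tsum b S]
  exact tsum_norm_sq_adjoint b b S

theorem posTrace_mul_mul_star {T : H →L[ℂ] H} (hT : T.IsPositive) {U : H →L[ℂ] H}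
    (hU : star U * U = 1) : posTrace (U * T * star U) = posTrace T := by
  obtain ⟨S, rfl⟩ := exists_eq_star_mul_self hT
  have h := posTrace_star_mul_self_comm (S * star U)
  rw [star_mul, star_star, mul_assoc, mul_assoc S, ← mul_assoc (star U), hU, one_mul] at h
  rw [← posTrace_star_mul_self_comm S] at h
  simpa only [mul_assoc] using h

theorem summable_norm_sq_of_posTrace_ne_top {T : H →L[ℂ] H} (hT : T.IsPositive)
    (htr : posTrace T ≠ ∞) {ι : Type*} (b : HilbertBasis ι ℂ H) :
    Summable fun i => ‖T (b i)‖ ^ 2 := by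
  obtain ⟨S, rfl⟩ := exists_eq_star_mul_self hT
  rw [posTrace_star_mul_self_eq_tsum b] at htr
  have hS : Summable fun i => ‖S (b i)‖ ^ 2 :=
    (ENNReal.summable_toReal htr).congr fun i => ENNReal.toReal_ofReal (by positivity)
  refine (hS.mul_left (‖star S‖ ^ 2)).of_nonneg_of_le (fun i => by positivity) fun i => ?_
  rw [← mul_pow]
  gcongr
  exact (star S).le_opNorm (S (b i))

theorem isCompactOperator_of_posTrace_ne_top {T : H →L[ℂ] H} (hT : T.IsPositive)
    (htr : posTrace T ≠ ∞) : IsCompactOperator T := by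
  obtain ⟨_, b, _⟩ := exists_hilbertBasis ℂ H
  refine isCompactOperator_of_tendsto
    (hasSum_rankOne_apply_hilbertBasis b (summable_norm_sq_of_posTrace_ne_top hT htr b))
    (Filter.Eventually.of_forall fun s => ?_)
  exact (compactOperator (RingHom.id ℂ) H H).sum_mem fun i _ => isCompactOperator_rankOne _ _

theorem IsDensityOperator.posTrace_ne_top {ρ : H →L[ℂ] H} (hρ : IsDensityOperator ρ) :
    posTrace ρ ≠ ∞ := by
  simp [hρ.posTrace_eq_one]

theorem posTrace_rankOne_self (x : H) :
    posTrace (InnerProductSpace.rankOne ℂ x x) = ENNReal.ofReal (‖x‖ ^ 2) := by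
  obtain ⟨_, b, _⟩ := exists_hilbertBasis ℂ H
  rw [posTrace_eq_tsum b (InnerProductSpace.isPositive_rankOne_self x), ← tsum_inner_sq_eq b x]
  refine tsum_congr fun i => ?_
  rw [InnerProductSpace.inner_right_rankOne_apply, ← inner_conj_symm x, Complex.mul_conj,
    Complex.normSq_eq_norm_sq, Complex.ofReal_re]

theorem isDensityOperator_rankOne_self {x : H} (hx : ‖x‖ = 1) :
    IsDensityOperator (InnerProductSpace.rankOne ℂ x x) :=
  ⟨InnerProductSpace.isPositive_rankOne_self x, by simp [posTrace_rankOne_self, hx]⟩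

theorem purity_rankOne_self {x : H} (hx : ‖x‖ = 1) :
    purity (InnerProductSpace.rankOne ℂ x x) = 1 := by
  rw [purity, (InnerProductSpace.isIdempotentElem_rankOne_self hx).eq,
    (isDensityOperator_rankOne_self hx).posTrace_eq_one, ENNReal.toReal_one]

end Trace

section Eigenbasis

variable {H : Type*} [NormedAddCommGroup H] [InnerProductSpace ℂ H]

/-- The Hilbert basis `b` diagonalizes `T`, with the nonnegative eigenvalues `p`. -/
def IsEigenbasis {ι : Type*} (T : H →L[ℂ] H) (b : HilbertBasis ι ℂ H) (p : ι → ℝ≥0) : Prop :=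
  ∀ i, T (b i) = ((p i : ℝ) : ℂ) • b i

namespace IsEigenbasis

variable {ι : Type*} {T : H →L[ℂ] H} {b : HilbertBasis ι ℂ H} {p : ι → ℝ≥0}

theorem inner_apply (h : IsEigenbasis T b p) (i : ι) (x : H) :
    ⟪b i, T x⟫_ℂ = (p i : ℝ) * ⟪b i, x⟫_ℂ := by
  suffices hext : innerSL ℂ (b i) ∘L T = ((p i : ℝ) : ℂ) • innerSL ℂ (b i) from
    congrArg (fun f : H →L[ℂ] ℂ => f x) hext
  refine continuousLinearMap_ext_hilbertBasis b fun j => ?_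
  rcases eq_or_ne i j with rfl | hij
  · simp [h i]
  · simp [h j, b.orthonormal.inner_eq_zero hij]

theorem mul_self (h : IsEigenbasis T b p) : IsEigenbasis (T * T) b fun i => p i ^ 2 := by
  intro i
  rw [mul_apply_eq_comp, h i, map_smul, h i, smul_smul, ← pow_two]
  push_cast
  rfl

open scoped ComplexOrder in
theorem isPositive (h : IsEigenbasis T b p) : T.IsPositive := by
  refine isPositive_of_forall_inner_nonneg fun x => ?_
  refine (b.hasSum_inner_mul_inner x (T x)).nonneg fun i => ?_
  rw [h.inner_apply, mul_left_comm, ← inner_conj_symm, Complex.conj_mul']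
  exact_mod_cast by positivity

variable [CompleteSpace H]

theorem posTrace_eq (h : IsEigenbasis T b p) : posTrace T = ∑' i, (p i : ℝ≥0∞) := by
  rw [posTrace_eq_tsum b h.isPositive]
  refine tsum_congr fun i => ?_
  rw [h i, inner_smul_right, inner_self_eq_one_of_norm_eq_one (b.orthonormal.1 i), mul_one,
    Complex.ofReal_re, ENNReal.ofReal_coe_nnreal]

theorem posTrace_mul_self_eq (h : IsEigenbasis T b p) :
    posTrace (T * T) = ∑' i, (p i : ℝ≥0∞) ^ 2 := by
  simp [h.mul_self.posTrace_eq]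

theorem eigenProj_apply (h : IsEigenbasis T b p) (a : ℝ≥0) (i : ι) :
    eigenProj T a (b i) = if p i = a then b i else 0 := by
  unfold eigenProj
  split_ifs with hi
  · rw [Submodule.starProjection_eq_self_iff]
    simp [LinearMap.mem_ker, h i, hi]
  · rw [Submodule.starProjection_apply_eq_zero_iff, Submodule.mem_orthogonal']
    intro u hu
    have hTu : T u = ((a : ℝ) : ℂ) • u := by
      simpa [LinearMap.mem_ker, sub_eq_zero] using hu
    have hmul := h.inner_apply i u
    rw [hTu, inner_smul_right, mul_eq_mul_right_iff] at hmul
    exact hmul.resolve_left fun ha => hi (by exact_mod_cast ha.symm)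

end IsEigenbasis

theorem exists_isEigenbasis.{u} {H : Type u} [NormedAddCommGroup H] [InnerProductSpace ℂ H]
    [CompleteSpace H] {T : H →L[ℂ] H} (hT : T.IsPositive) (htr : posTrace T ≠ ∞) :
    ∃ (ι : Type u) (b : HilbertBasis ι ℂ H) (p : ι → ℝ≥0), IsEigenbasis T b p := by
  have (a : ℂ) : CompleteSpace (Module.End.eigenspace (T : Module.End ℂ H) a) :=
    IsClosed.completeSpace_coe
  obtain ⟨ι, b, hb⟩ := exists_hilbertBasis_of_orthogonalFamily
    hT.isSymmetric.orthogonalFamily_eigenspaces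
    (ContinuousLinearMap.orthogonalComplement_iSup_eigenspaces_eq_bot
      (isCompactOperator_of_posTrace_ne_top hT htr) hT.isSymmetric)
  choose a ha using hb
  refine ⟨ι, b, fun i => ‖a i‖₊, fun i => ?_⟩
  have hTb : T (b i) = a i • b i := Module.End.mem_eigenspace_iff.mp (ha i)
  have hnonneg := hT.inner_nonneg_right (b i)
  rw [hTb, inner_smul_right, inner_self_eq_one_of_norm_eq_one (b.orthonormal.1 i),
    mul_one] at hnonneg
  rw [coe_nnnorm, ← Complex.eq_coe_norm_of_nonneg hnonneg, hTb]

theorem exists_eq_one_of_tsum_sq_eq_one {ι : Type*} {p : ι → ℝ≥0∞} (h : ∑' i, p i = 1)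
    (hsq : ∑' i, p i ^ 2 = 1) : ∃ i, p i = 1 := by
  have hle (i : ι) : p i ≤ 1 := h ▸ ENNReal.le_tsum i
  have hsq_le (i : ι) : p i ^ 2 ≤ p i := by
    rw [pow_two]; exact mul_le_of_le_one_left' (hle i)
  obtain ⟨i, hi⟩ : ∃ i, p i ≠ 0 := by
    by_contra! h0
    simp [h0] at h
  refine ⟨i, by_contra fun hne => ?_⟩
  have hlt : p i ^ 2 < p i := by
    rw [pow_two]
    simpa using ENNReal.mul_lt_mul_left hi ((hle i).trans_lt ENNReal.one_lt_top).ne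
      (lt_of_le_of_ne (hle i) hne)
  exact (ENNReal.tsum_lt_tsum (by simp [hsq]) hsq_le hlt).ne (hsq.trans h.symm)

theorem exists_apply_eq_self_of_purity_eq_one [CompleteSpace H] {ρ : H →L[ℂ] H}
    (hρ : IsDensityOperator ρ) (h : purity ρ = 1) : ∃ x : H, ‖x‖ = 1 ∧ ρ x = x := by
  obtain ⟨ι, b, p, hb⟩ := exists_isEigenbasis hρ.isPositive hρ.posTrace_ne_top
  rw [purity, ENNReal.toReal_eq_one_iff, hb.posTrace_mul_self_eq] at h
  obtain ⟨i, hi⟩ := exists_eq_one_of_tsum_sq_eq_one (hb.posTrace_eq ▸ hρ.posTrace_eq_one) h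
  refine ⟨b i, b.orthonormal.1 i, ?_⟩
  rw [hb i, ENNReal.coe_eq_one.mp hi, NNReal.coe_one, Complex.ofReal_one, one_smul]

end Eigenbasis

section ScalarRelEntropy

theorem mul_log_sub_mul_log_add_sub_nonneg {a b : ℝ} (ha : 0 < a) (hb : 0 < b) :
    0 ≤ a * Real.log a - a * Real.log b + b - a := by
  have h := mul_nonneg hb.le (InformationTheory.klFun_nonneg (div_pos ha hb).le)
  rw [InformationTheory.klFun, Real.log_div ha.ne' hb.ne'] at h
  field_simp at h
  linarith

theorem scalarRelEntropy_of_ne_zero {p q : ℝ≥0} (hp : p ≠ 0) (hq : q ≠ 0) :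
    scalarRelEntropy p q = NNReal.mk (p * Real.log p - p * Real.log q + q - p)
      (mul_log_sub_mul_log_add_sub_nonneg (NNReal.coe_pos.mpr hp.bot_lt)
        (NNReal.coe_pos.mpr hq.bot_lt)) := by
  rw [scalarRelEntropy, if_neg hp, if_neg hq, ENNReal.ofReal_eq_coe_nnreal]

/-- The two sides are arranged so that no subtraction in `[0, ∞]` occurs. -/
theorem scalarRelEntropy_mul (p q p' q' : ℝ≥0) :
    scalarRelEntropy (p * p') (q * q') + (p' * q + p * q') =
      p' * scalarRelEntropy p q + p * scalarRelEntropy p' q' + (q * q' + p * p') := by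
  rcases eq_or_ne p 0 with rfl | hp
  · simp [scalarRelEntropy, add_comm]
  rcases eq_or_ne p' 0 with rfl | hp'
  · simp [scalarRelEntropy, add_comm]
  rcases eq_or_ne q 0 with rfl | hq
  · simp [scalarRelEntropy, hp, hp', ENNReal.mul_top]
  rcases eq_or_ne q' 0 with rfl | hq'
  · simp [scalarRelEntropy, hp, hp', ENNReal.mul_top]
  rw [scalarRelEntropy_of_ne_zero hp hq, scalarRelEntropy_of_ne_zero hp' hq',
    scalarRelEntropy_of_ne_zero (mul_ne_zero hp hp') (mul_ne_zero hq hq')]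
  norm_cast
  apply NNReal.eq
  push_cast
  rw [Real.log_mul (by exact_mod_cast hp) (by exact_mod_cast hp'),
    Real.log_mul (by exact_mod_cast hq) (by exact_mod_cast hq')]
  ring

theorem tsum_mul_eq_tsum_mul_tsum {α β : Type*} (f : α → ℝ≥0∞) (g : β → ℝ≥0∞) :
    ∑' x : α × β, f x.1 * g x.2 = (∑' a, f a) * ∑' b, g b := by
  rw [ENNReal.tsum_prod', ← ENNReal.tsum_mul_right]
  simp only [ENNReal.tsum_mul_left]

theorem tsum_scalarRelEntropy_mul {α β : Type*} {w : α → ℝ≥0∞} {p q : α → ℝ≥0}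
    {w' : β → ℝ≥0∞} {p' q' : β → ℝ≥0} (hp : ∑' a, w a * p a = 1) (hq : ∑' a, w a * q a = 1)
    (hp' : ∑' b, w' b * p' b = 1) (hq' : ∑' b, w' b * q' b = 1) :
    ∑' x : α × β, w x.1 * w' x.2 * scalarRelEntropy (p x.1 * p' x.2) (q x.1 * q' x.2) =
      ∑' a, w a * scalarRelEntropy (p a) (q a) + ∑' b, w' b * scalarRelEntropy (p' b) (q' b) := by
  refine (ENNReal.add_left_inj (by simp : (1 + 1 : ℝ≥0∞) ≠ ∞)).mp ?_
  calc _ = ∑' x : α × β, w x.1 * w' x.2 *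
        (scalarRelEntropy (p x.1 * p' x.2) (q x.1 * q' x.2) +
          (p' x.2 * q x.1 + p x.1 * q' x.2)) := by
        have hcross (x : α × β) : w x.1 * w' x.2 * (p' x.2 * q x.1 + p x.1 * q' x.2 : ℝ≥0∞) =
            w x.1 * q x.1 * (w' x.2 * p' x.2) + w x.1 * p x.1 * (w' x.2 * q' x.2) := by ring
        simp only [mul_add (w _ * w' _) (scalarRelEntropy _ _), ENNReal.tsum_add, hcross,
          tsum_mul_eq_tsum_mul_tsum (fun a => w a * (q a : ℝ≥0∞)) fun b => w' b * (p' b : ℝ≥0∞),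
          tsum_mul_eq_tsum_mul_tsum (fun a => w a * (p a : ℝ≥0∞)) fun b => w' b * (q' b : ℝ≥0∞),
          hp, hq, hp', hq', mul_one]
    _ = ∑' x : α × β,
        (w x.1 * scalarRelEntropy (p x.1) (q x.1) * (w' x.2 * p' x.2) +
          w x.1 * p x.1 * (w' x.2 * scalarRelEntropy (p' x.2) (q' x.2)) +
          (w x.1 * q x.1 * (w' x.2 * q' x.2) + w x.1 * p x.1 * (w' x.2 * p' x.2))) :=
        tsum_congr fun x => by rw [scalarRelEntropy_mul]; ring
    _ = _ := by
        simp only [ENNReal.tsum_add,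
          tsum_mul_eq_tsum_mul_tsum (fun a => w a * scalarRelEntropy (p a) (q a))
            fun b => w' b * (p' b : ℝ≥0∞),
          tsum_mul_eq_tsum_mul_tsum (fun a => w a * (p a : ℝ≥0∞))
            fun b => w' b * scalarRelEntropy (p' b) (q' b),
          tsum_mul_eq_tsum_mul_tsum (fun a => w a * (q a : ℝ≥0∞)) fun b => w' b * (q' b : ℝ≥0∞),
          tsum_mul_eq_tsum_mul_tsum (fun a => w a * (p a : ℝ≥0∞)) fun b => w' b * (p' b : ℝ≥0∞),
          hp, hq, hp', hq', mul_one, one_mul]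

theorem tsum_tsum_ite_mul {α β γ : Type*} [DecidableEq β] [DecidableEq γ] (f : α → β) (g : α → γ)
    (w : α → ℝ≥0∞) (F : β → γ → ℝ≥0∞) :
    ∑' (s) (t), (∑' a, if f a = s ∧ g a = t then w a else 0) * F s t =
      ∑' a, w a * F (f a) (g a) := by
  rw [← ENNReal.tsum_prod]
  simp only [← ENNReal.tsum_mul_right]
  rw [ENNReal.tsum_comm]
  refine tsum_congr fun a => ?_
  rw [tsum_eq_single (f a, g a) fun x hx => ?_]
  · simp
  · rw [if_neg fun h => hx (Prod.ext h.1.symm h.2.symm), zero_mul]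

end ScalarRelEntropy

section RelEntropy

variable {H : Type*} [NormedAddCommGroup H] [InnerProductSpace ℂ H] {ι κ : Type*}

/-- The transition probabilities `|⟪cₖ, bᵢ⟫|²` between two Hilbert bases. -/
def transitionProb (b : HilbertBasis ι ℂ H) (c : HilbertBasis κ ℂ H) (x : ι × κ) : ℝ≥0∞ :=
  ENNReal.ofReal (‖⟪c x.2, b x.1⟫_ℂ‖ ^ 2)

variable [CompleteSpace H]

theorem tsum_transitionProb_mul_fst (b : HilbertBasis ι ℂ H) (c : HilbertBasis κ ℂ H)
    (p : ι → ℝ≥0∞) : ∑' x, transitionProb b c x * p x.1 = ∑' i, p i := by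
  simp only [ENNReal.tsum_prod', transitionProb, ENNReal.tsum_mul_right, tsum_inner_sq_eq,
    b.orthonormal.1, one_pow, ENNReal.ofReal_one, one_mul]

theorem tsum_transitionProb_mul_snd (b : HilbertBasis ι ℂ H) (c : HilbertBasis κ ℂ H)
    (q : κ → ℝ≥0∞) : ∑' x, transitionProb b c x * q x.2 = ∑' k, q k := by
  rw [← tsum_transitionProb_mul_fst c b q, ← (Equiv.prodComm ι κ).tsum_eq]
  exact tsum_congr fun x => by rw [transitionProb, norm_inner_symm]; rfl

theorem IsEigenbasis.tsum_transitionProb_mul_fst {T : H →L[ℂ] H} {b : HilbertBasis ι ℂ H}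
    {p : ι → ℝ≥0} (hb : IsEigenbasis T b p) (c : HilbertBasis κ ℂ H) :
    ∑' x, transitionProb b c x * p x.1 = posTrace T :=
  (Dephasing.tsum_transitionProb_mul_fst b c fun i => (p i : ℝ≥0∞)).trans hb.posTrace_eq.symm

theorem IsEigenbasis.tsum_transitionProb_mul_snd {T : H →L[ℂ] H} {c : HilbertBasis κ ℂ H}
    {q : κ → ℝ≥0} (hc : IsEigenbasis T c q) (b : HilbertBasis ι ℂ H) :
    ∑' x, transitionProb b c x * q x.2 = posTrace T :=
  (Dephasing.tsum_transitionProb_mul_snd b c fun k => (q k : ℝ≥0∞)).trans hc.posTrace_eq.symm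

theorem isStarProjection_eigenProj (T : H →L[ℂ] H) (a : ℝ≥0) : IsStarProjection (eigenProj T a) :=
  isStarProjection_starProjection

theorem posTrace_eigenProj_mul_eigenProj_mul_eigenProj {ρ σ : H →L[ℂ] H} {b : HilbertBasis ι ℂ H}
    {c : HilbertBasis κ ℂ H} {p : ι → ℝ≥0} {q : κ → ℝ≥0} (hb : IsEigenbasis ρ b p)
    (hc : IsEigenbasis σ c q) (s t : ℝ≥0) :
    posTrace (eigenProj ρ s * eigenProj σ t * eigenProj ρ s) =
      ∑' x : ι × κ, if p x.1 = s ∧ q x.2 = t then transitionProb b c x else 0 := by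
  have hP := isStarProjection_eigenProj ρ s
  have hQ := isStarProjection_eigenProj σ t
  have hfactor : eigenProj ρ s * eigenProj σ t * eigenProj ρ s =
      star (eigenProj σ t * eigenProj ρ s) * (eigenProj σ t * eigenProj ρ s) := by
    rw [star_mul, hP.isSelfAdjoint.star_eq, hQ.isSelfAdjoint.star_eq, mul_assoc, mul_assoc,
      ← mul_assoc (eigenProj σ t) (eigenProj σ t), hQ.isIdempotentElem.eq]
  rw [hfactor, posTrace_star_mul_self_eq_tsum b, ENNReal.tsum_prod']
  refine tsum_congr fun i => ?_
  rw [mul_apply_eq_comp, hb.eigenProj_apply, ← tsum_inner_sq_eq c]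
  refine tsum_congr fun k => ?_
  rw [← hQ.isSelfAdjoint.star_eq, ContinuousLinearMap.star_eq_adjoint,
    ContinuousLinearMap.adjoint_inner_right, hc.eigenProj_apply]
  by_cases hs : p i = s <;> by_cases ht : q k = t <;> simp [hs, ht, transitionProb]

theorem relEntropy_eq_tsum {ρ σ : H →L[ℂ] H} {b : HilbertBasis ι ℂ H}
    {c : HilbertBasis κ ℂ H} {p : ι → ℝ≥0} {q : κ → ℝ≥0} (hb : IsEigenbasis ρ b p)
    (hc : IsEigenbasis σ c q) :
    relEntropy ρ σ = ∑' x, transitionProb b c x * scalarRelEntropy (p x.1) (q x.2) := by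
  unfold relEntropy
  simp only [posTrace_eigenProj_mul_eigenProj_mul_eigenProj hb hc]
  exact tsum_tsum_ite_mul (fun x : ι × κ => p x.1) (fun x => q x.2) _ scalarRelEntropy

end RelEntropy

section Tensor

variable {H K : Type*} [NormedAddCommGroup H] [InnerProductSpace ℂ H]
  [NormedAddCommGroup K] [InnerProductSpace ℂ K] {ι κ ι' κ' : Type*}

/-- The elementary tensor `x ⊗ y` as an element of the Hilbert space tensor product. -/
def pureTensor (x : H) (y : K) : HilbertTensor H K := ((x ⊗ₜ[ℂ] y : H ⊗[ℂ] K) : HilbertTensor H K)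

theorem inner_pureTensor (x x' : H) (y y' : K) :
    ⟪pureTensor x y, pureTensor x' y'⟫_ℂ = ⟪x, x'⟫_ℂ * ⟪y, y'⟫_ℂ := by
  rw [pureTensor, pureTensor, UniformSpace.Completion.inner_coe, TensorProduct.inner_tmul]

theorem norm_pureTensor (x : H) (y : K) : ‖pureTensor x y‖ = ‖x‖ * ‖y‖ := by
  rw [pureTensor, UniformSpace.Completion.norm_coe, TensorProduct.norm_tmul]

theorem opTensor_pureTensor (A : H →L[ℂ] H) (B : K →L[ℂ] K) (x : H) (y : K) :
    opTensor A B (pureTensor x y) = pureTensor (A x) (B y) :=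
  opTensor_tmul A B x y

variable (H K) in
/-- The elementary tensor `pureTensor` as a bounded bilinear map. -/
def pureTensorL : H →L[ℂ] K →L[ℂ] HilbertTensor H K :=
  (ContinuousLinearMap.compL ℂ K (H ⊗[ℂ] K) (HilbertTensor H K)
    UniformSpace.Completion.toComplL) ∘L (TensorProduct.mkL ℂ H K)

theorem pureTensorL_apply (x : H) (y : K) : pureTensorL H K x y = pureTensor x y := rfl

theorem continuousLinearMap_ext_pureTensor {E : Type*} [NormedAddCommGroup E] [NormedSpace ℂ E]
    {S T : HilbertTensor H K →L[ℂ] E}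
    (h : ∀ x y, S (pureTensor x y) = T (pureTensor x y)) : S = T := by
  have halg : (S ∘L UniformSpace.Completion.toComplL : H ⊗[ℂ] K →ₗ[ℂ] E) =
      (T ∘L UniformSpace.Completion.toComplL : H ⊗[ℂ] K →L[ℂ] E) :=
    TensorProduct.ext' h
  exact DFunLike.coe_injective
    (UniformSpace.Completion.ext S.continuous T.continuous fun z => LinearMap.congr_fun halg z)

theorem opTensor_mul (A A' : H →L[ℂ] H) (B B' : K →L[ℂ] K) :
    opTensor (A * A') (B * B') = opTensor A B * opTensor A' B' :=
  continuousLinearMap_ext_pureTensor fun x y => by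
    simp only [mul_apply_eq_comp, opTensor_pureTensor]

theorem norm_opTensor_le (A : H →L[ℂ] H) (B : K →L[ℂ] K) : ‖opTensor A B‖ ≤ ‖A‖ * ‖B‖ := by
  refine ContinuousLinearMap.opNorm_le_bound _ (by positivity) fun z => ?_
  induction z using UniformSpace.Completion.induction_on with
  | hp => exact isClosed_le (by fun_prop) (by fun_prop)
  | ih z =>
    rw [opTensor, ContinuousLinearMap.completion_apply_coe, UniformSpace.Completion.norm_coe,
      UniformSpace.Completion.norm_coe]
    exact (TensorProduct.mapL A B).le_of_opNorm_le (TensorProduct.norm_mapL_le A B) z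

theorem opTensor_add_left (A A' : H →L[ℂ] H) (B : K →L[ℂ] K) :
    opTensor (A + A') B = opTensor A B + opTensor A' B :=
  continuousLinearMap_ext_pureTensor fun x y => by
    simp only [add_apply, opTensor_pureTensor]
    simp only [← pureTensorL_apply, map_add, add_apply]

theorem opTensor_add_right (A : H →L[ℂ] H) (B B' : K →L[ℂ] K) :
    opTensor A (B + B') = opTensor A B + opTensor A B' :=
  continuousLinearMap_ext_pureTensor fun x y => by
    simp only [add_apply, opTensor_pureTensor]
    simp only [← pureTensorL_apply, map_add]

theorem opTensor_smul_left (c : ℂ) (A : H →L[ℂ] H) (B : K →L[ℂ] K) :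
    opTensor (c • A) B = c • opTensor A B :=
  continuousLinearMap_ext_pureTensor fun x y => by
    simp only [smul_apply, opTensor_pureTensor]
    simp only [← pureTensorL_apply, map_smul, smul_apply]

theorem opTensor_smul_right (c : ℂ) (A : H →L[ℂ] H) (B : K →L[ℂ] K) :
    opTensor A (c • B) = c • opTensor A B :=
  continuousLinearMap_ext_pureTensor fun x y => by
    simp only [smul_apply, opTensor_pureTensor]
    simp only [← pureTensorL_apply, map_smul]

variable (H K) in
/-- The tensor product `opTensor` of operators as a bounded bilinear map. -/
def opTensorL : (H →L[ℂ] H) →L[ℂ] (K →L[ℂ] K) →L[ℂ] HilbertTensor H K →L[ℂ] HilbertTensor H K :=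
  LinearMap.mkContinuous₂ (E := H →L[ℂ] H) (F := K →L[ℂ] K)
    (G := HilbertTensor H K →L[ℂ] HilbertTensor H K)
    (LinearMap.mk₂ ℂ opTensor opTensor_add_left opTensor_smul_left opTensor_add_right
      opTensor_smul_right) 1 fun A B => (norm_opTensor_le A B).trans_eq (by rw [one_mul])

theorem opTensorL_apply (A : H →L[ℂ] H) (B : K →L[ℂ] K) : opTensorL H K A B = opTensor A B := rfl

theorem orthonormal_pureTensor {v : ι → H} {w : κ → K} (hv : Orthonormal ℂ v)
    (hw : Orthonormal ℂ w) : Orthonormal ℂ fun x : ι × κ => pureTensor (v x.1) (w x.2) :=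
  (hv.tmul hw).comp_linearIsometry UniformSpace.Completion.toComplₗᵢ

theorem orthogonal_span_pureTensor (b : HilbertBasis ι ℂ H) (c : HilbertBasis κ ℂ K) :
    (Submodule.span ℂ (Set.range fun x : ι × κ => pureTensor (b x.1) (c x.2)))ᗮ = ⊥ := by
  rw [eq_bot_iff]
  intro z hz
  have hbilin : ContinuousLinearMap.compL ℂ K _ ℂ (innerSL ℂ z) ∘L pureTensorL H K = 0 :=
    continuousLinearMap_ext_hilbertBasis b fun i => continuousLinearMap_ext_hilbertBasis c fun k =>
      (Submodule.mem_orthogonal' _ z).mp hz _ (Submodule.subset_span ⟨(i, k), rfl⟩)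
  have hzero : innerSL ℂ z = 0 := continuousLinearMap_ext_pureTensor fun x y =>
    DFunLike.congr_fun (DFunLike.congr_fun hbilin x) y
  exact inner_self_eq_zero.mp (DFunLike.congr_fun hzero z)

/-- The Hilbert basis `bᵢ ⊗ cₖ` of the Hilbert space tensor product. -/
def tensorBasis (b : HilbertBasis ι ℂ H) (c : HilbertBasis κ ℂ K) :
    HilbertBasis (ι × κ) ℂ (HilbertTensor H K) :=
  HilbertBasis.mkOfOrthogonalEqBot (orthonormal_pureTensor b.orthonormal c.orthonormal)
    (orthogonal_span_pureTensor b c)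

theorem tensorBasis_apply (b : HilbertBasis ι ℂ H) (c : HilbertBasis κ ℂ K) (x : ι × κ) :
    tensorBasis b c x = pureTensor (b x.1) (c x.2) := by
  rw [tensorBasis, HilbertBasis.coe_mkOfOrthogonalEqBot]

theorem transitionProb_tensorBasis (b : HilbertBasis ι ℂ H) (c : HilbertBasis κ ℂ H)
    (b' : HilbertBasis ι' ℂ K) (c' : HilbertBasis κ' ℂ K) (x : (ι × κ) × ι' × κ') :
    transitionProb (tensorBasis b b') (tensorBasis c c') (Equiv.prodProdProdComm ι κ ι' κ' x) =
      transitionProb b c x.1 * transitionProb b' c' x.2 := by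
  simp only [transitionProb, tensorBasis_apply, inner_pureTensor, norm_mul, mul_pow,
    Equiv.prodProdProdComm_apply]
  exact ENNReal.ofReal_mul (by positivity)

theorem IsEigenbasis.opTensor {A : H →L[ℂ] H} {B : K →L[ℂ] K} {b : HilbertBasis ι ℂ H}
    {c : HilbertBasis κ ℂ K} {p : ι → ℝ≥0} {q : κ → ℝ≥0} (hb : IsEigenbasis A b p)
    (hc : IsEigenbasis B c q) :
    IsEigenbasis (opTensor A B) (tensorBasis b c) fun x => p x.1 * q x.2 := by
  intro x
  rw [tensorBasis_apply, opTensor_pureTensor, hb, hc]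
  simp only [← pureTensorL_apply, map_smul, smul_apply, smul_smul]
  push_cast
  rw [mul_comm]

variable [CompleteSpace H] [CompleteSpace K]

theorem star_opTensor (A : H →L[ℂ] H) (B : K →L[ℂ] K) :
    star (opTensor A B) = opTensor (star A) (star B) := by
  refine continuousLinearMap_ext_pureTensor fun x y => ext_inner_right ℂ fun z => ?_
  have h : innerSL ℂ (star (opTensor A B) (pureTensor x y)) =
      innerSL ℂ (opTensor (star A) (star B) (pureTensor x y)) :=
    continuousLinearMap_ext_pureTensor fun x' y' => by
      simp only [innerSL_apply_apply, ContinuousLinearMap.star_eq_adjoint,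
        ContinuousLinearMap.adjoint_inner_left, opTensor_pureTensor, inner_pureTensor]
  exact DFunLike.congr_fun h z

theorem opTensor_star_mul_self (S : H →L[ℂ] H) (T : K →L[ℂ] K) :
    opTensor (star S * S) (star T * T) = star (opTensor S T) * opTensor S T := by
  rw [opTensor_mul, star_opTensor]

theorem isPositive_opTensor {A : H →L[ℂ] H} {B : K →L[ℂ] K} (hA : A.IsPositive)
    (hB : B.IsPositive) : (opTensor A B).IsPositive := by
  obtain ⟨S, rfl⟩ := exists_eq_star_mul_self hA
  obtain ⟨T, rfl⟩ := exists_eq_star_mul_self hB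
  rw [opTensor_star_mul_self]
  exact isPositive_star_mul_self _

theorem posTrace_opTensor {A : H →L[ℂ] H} {B : K →L[ℂ] K} (hA : A.IsPositive)
    (hB : B.IsPositive) : posTrace (opTensor A B) = posTrace A * posTrace B := by
  obtain ⟨_, b, _⟩ := exists_hilbertBasis ℂ H
  obtain ⟨_, c, _⟩ := exists_hilbertBasis ℂ K
  obtain ⟨S, rfl⟩ := exists_eq_star_mul_self hA
  obtain ⟨T, rfl⟩ := exists_eq_star_mul_self hB
  rw [opTensor_star_mul_self, posTrace_star_mul_self_eq_tsum (tensorBasis b c),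
    posTrace_star_mul_self_eq_tsum b, posTrace_star_mul_self_eq_tsum c,
    ← tsum_mul_eq_tsum_mul_tsum]
  refine tsum_congr fun x => ?_
  rw [tensorBasis_apply, opTensor_pureTensor, norm_pureTensor, mul_pow,
    ENNReal.ofReal_mul (by positivity)]

theorem IsDensityOperator.opTensor {A : H →L[ℂ] H} {B : K →L[ℂ] K} (hA : IsDensityOperator A)
    (hB : IsDensityOperator B) : IsDensityOperator (opTensor A B) :=
  ⟨isPositive_opTensor hA.isPositive hB.isPositive, by
    rw [posTrace_opTensor hA.isPositive hB.isPositive, hA.posTrace_eq_one, hB.posTrace_eq_one,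
      one_mul]⟩

theorem isPositive_mul_self {A : H →L[ℂ] H} (hA : A.IsPositive) : (A * A).IsPositive := by
  simpa only [hA.isSelfAdjoint.star_eq] using isPositive_star_mul_self A

theorem purity_opTensor {A : H →L[ℂ] H} {B : K →L[ℂ] K} (hA : A.IsPositive)
    (hB : B.IsPositive) : purity (opTensor A B) = purity A * purity B := by
  rw [purity, ← opTensor_mul, posTrace_opTensor (isPositive_mul_self hA) (isPositive_mul_self hB),
    ENNReal.toReal_mul, purity, purity]

theorem relEntropy_opTensor {ρ σ : H →L[ℂ] H} {ρ' σ' : K →L[ℂ] K} (hρ : IsDensityOperator ρ)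
    (hσ : IsDensityOperator σ) (hρ' : IsDensityOperator ρ') (hσ' : IsDensityOperator σ') :
    relEntropy (opTensor ρ ρ') (opTensor σ σ') = relEntropy ρ σ + relEntropy ρ' σ' := by
  obtain ⟨ι, b, p, hb⟩ := exists_isEigenbasis hρ.isPositive hρ.posTrace_ne_top
  obtain ⟨κ, c, q, hc⟩ := exists_isEigenbasis hσ.isPositive hσ.posTrace_ne_top
  obtain ⟨ι', b', p', hb'⟩ := exists_isEigenbasis hρ'.isPositive hρ'.posTrace_ne_top
  obtain ⟨κ', c', q', hc'⟩ := exists_isEigenbasis hσ'.isPositive hσ'.posTrace_ne_top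
  rw [relEntropy_eq_tsum (hb.opTensor hb') (hc.opTensor hc'), relEntropy_eq_tsum hb hc,
    relEntropy_eq_tsum hb' hc', ← (Equiv.prodProdProdComm ι κ ι' κ').tsum_eq]
  simp only [transitionProb_tensorBasis]
  exact tsum_scalarRelEntropy_mul (p := fun x : ι × κ => p x.1) (q := fun x => q x.2)
    (p' := fun x : ι' × κ' => p' x.1) (q' := fun x => q' x.2)
    ((hb.tsum_transitionProb_mul_fst c).trans hρ.posTrace_eq_one)
    ((hc.tsum_transitionProb_mul_snd b).trans hσ.posTrace_eq_one)
    ((hb'.tsum_transitionProb_mul_fst c').trans hρ'.posTrace_eq_one)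
    ((hc'.tsum_transitionProb_mul_snd b').trans hσ'.posTrace_eq_one)

end Tensor

section OperatorIntegral

variable {H X : Type*} [NormedAddCommGroup H] [InnerProductSpace ℂ H] [CompleteSpace H]
  [MeasurableSpace X] {μ : Measure X} {f : X → H →L[ℂ] H}

theorem isPositive_integral (hf : ∀ x, (f x).IsPositive) : (∫ x, f x ∂μ).IsPositive :=
  (ContinuousLinearMap.nonneg_iff_isPositive _).mp
    (integral_nonneg fun x => (ContinuousLinearMap.nonneg_iff_isPositive _).mpr (hf x))

theorem re_inner_integral_apply (hf : Integrable f μ) (u v : H) :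
    (⟪u, (∫ x, f x ∂μ) v⟫_ℂ).re = ∫ x, (⟪u, f x v⟫_ℂ).re ∂μ :=
  ((Complex.reCLM ∘L ((innerSL ℂ u ∘L ContinuousLinearMap.apply ℂ H v).restrictScalars ℝ)
    ).integral_comp_comm hf).symm

omit [CompleteSpace H] in
theorem integrable_re_inner_apply (hf : Integrable f μ) (u v : H) :
    Integrable (fun x => (⟪u, f x v⟫_ℂ).re) μ :=
  ((hf.apply_continuousLinearMap v).const_inner (𝕜 := ℂ) u).re

theorem posTrace_integral [TopologicalSpace.SeparableSpace H] (hint : Integrable f μ)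
    (hpos : ∀ x, (f x).IsPositive) : posTrace (∫ x, f x ∂μ) = ∫⁻ x, posTrace (f x) ∂μ := by
  obtain ⟨_, b, _⟩ := exists_hilbertBasis ℂ H
  have := countable_of_hilbertBasis b
  have hdiag i := integrable_re_inner_apply hint (b i) (b i)
  simp only [posTrace_eq_tsum b (isPositive_integral hpos), posTrace_eq_tsum b (hpos _)]
  rw [lintegral_tsum fun i => (hdiag i).aemeasurable.ennreal_ofReal]
  refine tsum_congr fun i => ?_
  rw [re_inner_integral_apply hint, ofReal_integral_eq_lintegral_ofReal (hdiag i)]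
  exact Filter.Eventually.of_forall fun x => (hpos x).re_inner_nonneg_right (b i)

end OperatorIntegral

section RandomUnitary

variable {H K X Y : Type*} [NormedAddCommGroup H] [InnerProductSpace ℂ H] [CompleteSpace H]
  [NormedAddCommGroup K] [InnerProductSpace ℂ K] [CompleteSpace K]
  [MeasurableSpace X] [MeasurableSpace Y] {μ : Measure X} {ν : Measure Y}
  {U : X → H →L[ℂ] H} {T : H →L[ℂ] H}

/-- The random unitary channel `T ↦ ∫ Uₓ T Uₓ* dμ(x)`. That the `Uₓ` are isometric is not part of
the definition but a hypothesis `star (U x) * U x = 1` of the lemmas. -/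
def randomUnitary (μ : Measure X) (U : X → H →L[ℂ] H) (T : H →L[ℂ] H) : H →L[ℂ] H :=
  ∫ x, U x * T * star (U x) ∂μ

theorem mul_rankOne_mul_star (S : H →L[ℂ] H) (u v : H) :
    S * InnerProductSpace.rankOne ℂ u v * star S = InnerProductSpace.rankOne ℂ (S u) (S v) := by
  ext w
  simp [ContinuousLinearMap.star_eq_adjoint, ContinuousLinearMap.adjoint_inner_right]

theorem norm_apply_of_star_mul_self_eq_one {S : H →L[ℂ] H} (hS : star S * S = 1) (v : H) :
    ‖S v‖ = ‖v‖ :=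
  S.norm_map_iff_adjoint_comp_self.mpr hS v

theorem norm_mul_mul_star_le {S : H →L[ℂ] H} (hS : star S * S = 1) (T : H →L[ℂ] H) :
    ‖S * T * star S‖ ≤ ‖T‖ := by
  have hle : ‖S‖ ≤ 1 := S.opNorm_le_bound zero_le_one fun v => by
    rw [norm_apply_of_star_mul_self_eq_one hS, one_mul]
  calc ‖S * T * star S‖ ≤ ‖S‖ * ‖T‖ * ‖star S‖ := norm_mul₃_le
    _ ≤ 1 * ‖T‖ * 1 := by rw [norm_star]; gcongr
    _ = ‖T‖ := by ring

/-- Strong measurability of `U` gives norm measurability here because `T` is a norm limit of finite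
rank operators. -/
theorem aestronglyMeasurable_mul_mul_star [TopologicalSpace.SeparableSpace H]
    (hU : ∀ v, AEStronglyMeasurable (fun x => U x v) μ) (hT : T.IsPositive)
    (htr : posTrace T ≠ ∞) : AEStronglyMeasurable (fun x => U x * T * star (U x)) μ := by
  obtain ⟨_, b, _⟩ := exists_hilbertBasis ℂ H
  have := countable_of_hilbertBasis b
  have hsum := hasSum_rankOne_apply_hilbertBasis b (summable_norm_sq_of_posTrace_ne_top hT htr b)
  have hconj x : HasSum (fun i => InnerProductSpace.rankOne ℂ (U x (T (b i))) (U x (b i)))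
      (U x * T * star (U x)) := by
    simpa only [mul_rankOne_mul_star] using (hsum.mul_left (U x)).mul_right (star (U x))
  have hcont : Continuous fun w : H × H => InnerProductSpace.rankOne ℂ w.1 w.2 := by
    simp only [InnerProductSpace.rankOne_def]
    fun_prop
  have hterm i : AEStronglyMeasurable
      (fun x => InnerProductSpace.rankOne ℂ (U x (T (b i))) (U x (b i))) μ :=
    (hcont.comp_aestronglyMeasurable ((hU (T (b i))).prodMk (hU (b i))) :)
  exact aestronglyMeasurable_of_tendsto_ae Filter.atTop
    (fun s => Finset.aestronglyMeasurable_fun_sum s fun i _ => hterm i)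
    (.of_forall fun x => by simpa only [HasSum, SummationFilter.unconditional_filter] using hconj x)

theorem integrable_mul_mul_star [TopologicalSpace.SeparableSpace H] [IsFiniteMeasure μ]
    (hU : ∀ v, AEStronglyMeasurable (fun x => U x v) μ) (hiso : ∀ x, star (U x) * U x = 1)
    (hT : T.IsPositive) (htr : posTrace T ≠ ∞) :
    Integrable (fun x => U x * T * star (U x)) μ :=
  .of_bound (aestronglyMeasurable_mul_mul_star hU hT htr) ‖T‖
    (.of_forall fun x => norm_mul_mul_star_le (hiso x) T)

theorem isPositive_mul_mul_star (hT : T.IsPositive) (S : H →L[ℂ] H) :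
    (S * T * star S).IsPositive :=
  hT.conj_adjoint S

theorem IsDensityOperator.randomUnitary [TopologicalSpace.SeparableSpace H]
    [IsProbabilityMeasure μ] (hT : IsDensityOperator T)
    (hU : ∀ v, AEStronglyMeasurable (fun x => U x v) μ) (hiso : ∀ x, star (U x) * U x = 1) :
    IsDensityOperator (randomUnitary μ U T) := by
  have hpos x := isPositive_mul_mul_star hT.isPositive (U x)
  refine ⟨isPositive_integral hpos, ?_⟩
  have hint := integrable_mul_mul_star hU hiso hT.isPositive hT.posTrace_ne_top
  simp [Dephasing.randomUnitary, posTrace_integral hint hpos,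
    posTrace_mul_mul_star hT.isPositive (hiso _), hT.posTrace_eq_one]

theorem randomUnitary_opTensor [SigmaFinite μ] [SigmaFinite ν] {V : Y → K →L[ℂ] K}
    {S : K →L[ℂ] K} (hT : Integrable (fun x => U x * T * star (U x)) μ)
    (hS : Integrable (fun y => V y * S * star (V y)) ν) :
    randomUnitary (μ.prod ν) (fun z => opTensor (U z.1) (V z.2)) (opTensor T S) =
      opTensor (randomUnitary μ U T) (randomUnitary ν V S) := by
  have hbilin := integral_prod_bilin (𝕜 := ℂ)
    (G := HilbertTensor H K →L[ℂ] HilbertTensor H K) (opTensorL H K) hT hS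
  simp only [opTensorL_apply] at hbilin
  simp only [randomUnitary, star_opTensor, ← opTensor_mul, hbilin]

/-- A unit eigenvector `v` of the mixture for the eigenvalue `1` satisfies
`∫ |⟪v, Uₓ u⟫|² dμ(x) = 1`, which forces equality in the Cauchy-Schwarz inequality. -/
theorem exists_ae_eq_smul_of_purity_randomUnitary_eq_one [TopologicalSpace.SeparableSpace H]
    [IsProbabilityMeasure μ] (hU : ∀ v, AEStronglyMeasurable (fun x => U x v) μ)
    (hiso : ∀ x, star (U x) * U x = 1) {u : H} (hu : ‖u‖ = 1)
    (hpur : purity (randomUnitary μ U (InnerProductSpace.rankOne ℂ u u)) = 1) :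
    ∃ v : H, ∀ᵐ x ∂μ, ∃ c : ℂ, c ≠ 0 ∧ U x u = c • v := by
  have hρ := isDensityOperator_rankOne_self hu
  obtain ⟨v, hv, hfix⟩ := exists_apply_eq_self_of_purity_eq_one (hρ.randomUnitary hU hiso) hpur
  have hUu x : ‖U x u‖ = 1 := (norm_apply_of_star_mul_self_eq_one (hiso x) u).trans hu
  have hint := integrable_mul_mul_star hU hiso hρ.isPositive hρ.posTrace_ne_top
  have hoverlap x : (⟪v, (U x * InnerProductSpace.rankOne ℂ u u * star (U x)) v⟫_ℂ).re =
      ‖⟪v, U x u⟫_ℂ‖ ^ 2 := by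
    rw [mul_rankOne_mul_star, InnerProductSpace.inner_right_rankOne_apply,
      ← inner_conj_symm (U x u), Complex.mul_conj, Complex.normSq_eq_norm_sq, Complex.ofReal_re]
  have hmean : ∫ x, ‖⟪v, U x u⟫_ℂ‖ ^ 2 ∂μ = ∫ _, 1 ∂μ := by
    rw [randomUnitary] at hfix
    simp only [← hoverlap, ← re_inner_integral_apply hint]
    simp [hfix, hv]
  have hle x : ‖⟪v, U x u⟫_ℂ‖ ^ 2 ≤ 1 := pow_le_one₀ (norm_nonneg _) <|
    (norm_inner_le_norm v (U x u)).trans_eq (by rw [hv, hUu, one_mul])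
  have hae := (integral_eq_iff_of_ae_le
    ((integrable_re_inner_apply hint v v).congr (.of_forall hoverlap))
    (integrable_const 1) (.of_forall hle)).mp hmean
  refine ⟨v, ?_⟩
  filter_upwards [hae] with x hx
  have hx : ‖⟪v, U x u⟫_ℂ‖ = ‖v‖ * ‖U x u‖ := by
    rw [hv, hUu, one_mul]
    exact (pow_eq_one_iff_of_nonneg (norm_nonneg _) two_ne_zero).mp hx
  exact (norm_inner_eq_norm_iff (norm_ne_zero_iff.mp (by simp [hv]))
    (norm_ne_zero_iff.mp (by simp [hUu]))).mp hx

end RandomUnitary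

section StrongContinuity

theorem continuous_of_continuous_inner_of_norm_eq {X E : Type*} [TopologicalSpace X]
    [NormedAddCommGroup E] [InnerProductSpace ℂ E] {f : X → E} {r : ℝ} (hnorm : ∀ x, ‖f x‖ = r)
    (hinner : ∀ v, Continuous fun x => ⟪v, f x⟫_ℂ) : Continuous f := by
  refine continuous_iff_continuousAt.mpr fun y => tendsto_iff_norm_sub_tendsto_zero.mpr ?_
  have hdist x : ‖f x - f y‖ = √(r ^ 2 - 2 * (⟪f y, f x⟫_ℂ).re + r ^ 2) := by
    have hsq := norm_sub_sq (𝕜 := ℂ) (f x) (f y)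
    rw [hnorm, hnorm, inner_re_symm] at hsq
    rw [← Real.sqrt_sq (norm_nonneg (f x - f y)), hsq]
    rfl
  have hcont : Continuous fun x => ‖f x - f y‖ := by
    have := hinner (f y)
    simp only [hdist]
    fun_prop
  simpa using hcont.tendsto y

end StrongContinuity

section NonvanishingVector

theorem exists_memLp_two_pos {X : Type*} [MeasurableSpace X] (μ : Measure X) [SigmaFinite μ] :
    ∃ f : X → ℝ, MemLp f 2 μ ∧ ∀ x, 0 < f x := by
  obtain ⟨g, hpos, hmeas, hlt⟩ := exists_pos_lintegral_lt_of_sigmaFinite μ one_ne_zero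
  refine ⟨fun x => √(g x), ?_, fun x => Real.sqrt_pos.mpr (hpos x)⟩
  rw [memLp_two_iff_integrable_sq (by fun_prop)]
  simp only [Real.sq_sqrt NNReal.zero_le_coe]
  exact ⟨by fun_prop, by simpa [HasFiniteIntegral] using hlt.trans ENNReal.one_lt_top⟩

theorem exists_norm_eq_one_ae_ne_zero {X : Type*} [MeasurableSpace X] (μ : Measure X)
    [SigmaFinite μ] [NeZero μ] : ∃ ψ : Lp ℂ 2 μ, ‖ψ‖ = 1 ∧ ∀ᵐ x ∂μ, ψ x ≠ 0 := by
  obtain ⟨f, hf, hpos⟩ := exists_memLp_two_pos μ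
  have hfℂ : MemLp (fun x => (f x : ℂ)) 2 μ := hf.ofReal
  let φ : Lp ℂ 2 μ := hfℂ.toLp
  have hφ : ∀ᵐ x ∂μ, φ x ≠ 0 := by
    filter_upwards [hfℂ.coeFn_toLp] with x hx
    simpa [φ, hx] using (hpos x).ne'
  have hφ0 : φ ≠ 0 := fun h0 => by
    obtain ⟨x, hx, hx0⟩ := (hφ.and (Lp.coeFn_zero ℂ 2 μ)).exists
    exact hx (by rw [h0, hx0, Pi.zero_apply])
  refine ⟨(‖φ‖ : ℂ)⁻¹ • φ, norm_smul_inv_norm hφ0, ?_⟩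
  filter_upwards [hφ, Lp.coeFn_smul ((‖φ‖ : ℂ)⁻¹) φ] with x hx hsmul
  rw [hsmul, Pi.smul_apply, smul_eq_mul]
  exact mul_ne_zero (inv_ne_zero (by exact_mod_cast norm_ne_zero_iff.mpr hφ0)) hx

end NonvanishingVector

section Kick

theorem phase_zero_left (ħ x : ℝ) : phase ħ 0 x = 1 := by simp [phase]

theorem phase_zero_right (ħ p : ℝ) : phase ħ p 0 = 1 := by simp [phase]

theorem phase_add (ħ p q x : ℝ) : phase ħ (p + q) x = phase ħ p x * phase ħ q x := by
  rw [phase, phase, phase, ← Complex.exp_add]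
  push_cast
  ring_nf

theorem conj_phase (ħ p x : ℝ) : starRingEnd ℂ (phase ħ p x) = phase ħ (-p) x := by
  rw [phase, phase, ← Complex.exp_conj]
  simp
  ring_nf

theorem continuous_phase_left (ħ x : ℝ) : Continuous fun p => phase ħ p x := by
  unfold phase; fun_prop

theorem kick_zero (ħ : ℝ) : kick ħ 0 = 1 := by
  refine ContinuousLinearMap.ext fun ψ => Lp.ext ?_
  filter_upwards [coeFn_kick ħ 0 ψ] with x hx
  rw [hx, phase_zero_left, one_mul, one_apply_eq_self]

theorem kick_mul_kick (ħ p q : ℝ) : kick ħ p * kick ħ q = kick ħ (p + q) := by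
  refine ContinuousLinearMap.ext fun ψ => Lp.ext ?_
  filter_upwards [coeFn_kick ħ p (kick ħ q ψ), coeFn_kick ħ q ψ, coeFn_kick ħ (p + q) ψ]
    with x hp hq hpq
  rw [mul_apply_eq_comp, hp, hq, hpq, phase_add, mul_assoc]

theorem star_kick (ħ p : ℝ) : star (kick ħ p) = kick ħ (-p) := by
  rw [ContinuousLinearMap.star_eq_adjoint, eq_comm, ContinuousLinearMap.eq_adjoint_iff]
  intro φ ψ
  rw [L2.inner_def, L2.inner_def]
  refine integral_congr_ae ?_
  filter_upwards [coeFn_kick ħ p ψ, coeFn_kick ħ (-p) φ] with x hψ hφ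
  simp only [hψ, hφ, RCLike.inner_apply, map_mul, conj_phase, neg_neg]
  ring

theorem star_kick_mul_kick (ħ p : ℝ) : star (kick ħ p) * kick ħ p = 1 := by
  rw [star_kick, kick_mul_kick, neg_add_cancel, kick_zero]

theorem inner_kick_apply (ħ p : ℝ) (φ ψ : L2R) :
    ⟪φ, kick ħ p ψ⟫_ℂ = ∫ x, phase ħ p x * ⟪φ x, ψ x⟫_ℂ := by
  rw [L2.inner_def]
  refine integral_congr_ae ?_
  filter_upwards [coeFn_kick ħ p ψ] with x hx
  rw [hx, ← smul_eq_mul, inner_smul_right]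

theorem continuous_inner_kick_apply (ħ : ℝ) (φ ψ : L2R) :
    Continuous fun p => ⟪φ, kick ħ p ψ⟫_ℂ := by
  simp only [inner_kick_apply]
  have hint := L2.integrable_inner (𝕜 := ℂ) φ ψ
  refine continuous_of_dominated (bound := fun x => ‖⟪φ x, ψ x⟫_ℂ‖)
    (fun p => (continuous_phase ħ p).aestronglyMeasurable.mul hint.aestronglyMeasurable)
    (fun p => .of_forall fun x => ?_) hint.norm
    (.of_forall fun x => (continuous_phase_left ħ x).mul continuous_const)
  rw [norm_mul, norm_phase, one_mul]

theorem continuous_kick_apply (ħ : ℝ) (ψ : L2R) : Continuous fun p => kick ħ p ψ :=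
  continuous_of_continuous_inner_of_norm_eq
    (fun p => norm_apply_of_star_mul_self_eq_one (star_kick_mul_kick ħ p) ψ)
    fun φ => continuous_inner_kick_apply ħ φ ψ

theorem aestronglyMeasurable_kick_apply (ħ : ℝ) (μ : Measure ℝ) (ψ : L2R) :
    AEStronglyMeasurable (fun p => kick ħ p ψ) μ :=
  (continuous_kick_apply ħ ψ).aestronglyMeasurable

/-- Phases are continuous in `x` and equal `1` at `x = 0`, so they cannot differ by a constant
factor. -/
theorem phase_eq_of_kick_apply_eq_smul {ħ p q : ℝ} {c : ℂ} {ψ : L2R} (hψ : ∀ᵐ x, ψ x ≠ 0)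
    (h : kick ħ p ψ = c • kick ħ q ψ) : phase ħ p = phase ħ q := by
  have hae : phase ħ p =ᵐ[volume] fun x => c * phase ħ q x := by
    filter_upwards [hψ, coeFn_kick ħ p ψ, coeFn_kick ħ q ψ, Lp.coeFn_smul c (kick ħ q ψ)]
      with x hx hp hq hc
    rw [h, hc, Pi.smul_apply, smul_eq_mul, hq, ← mul_assoc] at hp
    exact (mul_right_cancel₀ hx hp).symm
  have heq : phase ħ p = fun x => c * phase ħ q x :=
    (Continuous.ae_eq_iff_eq volume (continuous_phase ħ p)
      (continuous_const.mul (continuous_phase ħ q))).mp hae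
  have hc : c = 1 := by simpa only [phase_zero_right, mul_one] using (congrFun heq 0).symm
  simpa only [hc, one_mul] using heq

end Kick

section Dephase

instance separableSpace_L2R : TopologicalSpace.SeparableSpace L2R :=
  have : Fact ((2 : ℝ≥0∞) ≠ ∞) := ⟨by simp⟩
  inferInstance

variable {ħ : ℝ} {μ ν : Measure ℝ} {ρ σ : L2R →L[ℂ] L2R}

theorem dephase_eq_randomUnitary (ħ : ℝ) (μ : Measure ℝ) :
    dephase ħ μ = randomUnitary μ (kick ħ) := by
  ext1 ρ
  simp only [dephase, randomUnitary, star_kick]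
  rfl

theorem dephaseProd_eq_randomUnitary (ħ : ℝ) (μ ν : Measure ℝ) :
    dephaseProd ħ μ ν =
      randomUnitary (μ.prod ν) (fun z => opTensor (kick ħ z.1) (kick ħ z.2)) := by
  ext1 ρ
  simp only [dephaseProd, randomUnitary, star_opTensor, star_kick]

variable [IsProbabilityMeasure μ] [IsProbabilityMeasure ν]

theorem IsDensityOperator.dephase (hρ : IsDensityOperator ρ) :
    IsDensityOperator (dephase ħ μ ρ) := by
  rw [dephase_eq_randomUnitary]
  exact hρ.randomUnitary (aestronglyMeasurable_kick_apply ħ μ) (star_kick_mul_kick ħ)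

theorem dephaseProd_opTensor (hρ : IsDensityOperator ρ) (hσ : IsDensityOperator σ) :
    dephaseProd ħ μ ν (opTensor ρ σ) = opTensor (dephase ħ μ ρ) (dephase ħ ν σ) := by
  have hint (κ : Measure ℝ) [IsProbabilityMeasure κ] {τ : L2R →L[ℂ] L2R}
      (hτ : IsDensityOperator τ) : Integrable (fun p => kick ħ p * τ * star (kick ħ p)) κ :=
    integrable_mul_mul_star (aestronglyMeasurable_kick_apply ħ κ) (star_kick_mul_kick ħ)
      hτ.isPositive hτ.posTrace_ne_top
  rw [dephaseProd_eq_randomUnitary, dephase_eq_randomUnitary, dephase_eq_randomUnitary,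
    randomUnitary_opTensor (hint μ hρ) (hint ν hσ)]

theorem relEntropyLoss_dephaseProd_opTensor (hρ : IsDensityOperator ρ)
    (hσ : IsDensityOperator σ) :
    relEntropyLoss (dephaseProd ħ μ ν) (opTensor ρ σ) =
      relEntropyLoss (dephase ħ μ) ρ + relEntropyLoss (dephase ħ ν) σ := by
  simp only [relEntropyLoss, dephaseProd_opTensor hρ hσ,
    relEntropy_opTensor hρ hρ.dephase hσ hσ.dephase]

theorem hilbertSchmidtLoss_dephaseProd_opTensor (hρ : IsDensityOperator ρ)
    (hσ : IsDensityOperator σ) :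
    hilbertSchmidtLoss (dephaseProd ħ μ ν) (opTensor ρ σ) =
      purity ρ * purity σ - purity (dephase ħ μ ρ) * purity (dephase ħ ν σ) := by
  rw [hilbertSchmidtLoss, dephaseProd_opTensor hρ hσ,
    purity_opTensor hρ.isPositive hσ.isPositive,
    purity_opTensor hρ.dephase.isPositive hσ.dephase.isPositive]

theorem purity_dephase_rankOne_ne_one (hμ : ∃ ξ, ‖dephasingFun ħ μ ξ‖ < 1) {ψ : L2R}
    (hnorm : ‖ψ‖ = 1) (hψ : ∀ᵐ x, ψ x ≠ 0) :
    purity (dephase ħ μ (InnerProductSpace.rankOne ℂ ψ ψ)) ≠ 1 := by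
  intro hpur
  rw [dephase_eq_randomUnitary] at hpur
  obtain ⟨φ, hφ⟩ := exists_ae_eq_smul_of_purity_randomUnitary_eq_one
    (aestronglyMeasurable_kick_apply ħ μ) (star_kick_mul_kick ħ) hnorm hpur
  obtain ⟨q, c, hc, hq⟩ := hφ.exists
  have hphase : ∀ᵐ p ∂μ, phase ħ p = phase ħ q := by
    filter_upwards [hφ] with p ⟨d, _, hp⟩
    refine phase_eq_of_kick_apply_eq_smul hψ (c := d * c⁻¹) ?_
    rw [hq, hp, smul_smul, inv_mul_cancel_right₀ hc]
  obtain ⟨ξ, hξ⟩ := hμ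
  have hconst : dephasingFun ħ μ ξ = phase ħ q ξ := by
    rw [dephasingFun, integral_congr_ae (hphase.mono fun p hp => congrFun hp ξ)]
    simp
  exact hξ.ne (by rw [hconst, norm_phase])

end Dephase

end Dephasing

end

open Dephasing

theorem mainTheorem7 (ħ : ℝ) (hħ : 0 < ħ) (μA μB : Measure ℝ)
    [IsProbabilityMeasure μA] [IsProbabilityMeasure μB] :
    (∀ ρA ρB : L2R →L[ℂ] L2R, IsDensityOperator ρA → IsDensityOperator ρB →
      (IsDensityOperator (opTensor ρA ρB) ∧
        IsDensityOperator (dephase ħ μA ρA) ∧ IsDensityOperator (dephase ħ μB ρB) ∧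
        dephaseProd ħ μA μB (opTensor ρA ρB) =
          opTensor (dephase ħ μA ρA) (dephase ħ μB ρB)) ∧
      relEntropyLoss (dephaseProd ħ μA μB) (opTensor ρA ρB) =
        relEntropyLoss (dephase ħ μA) ρA + relEntropyLoss (dephase ħ μB) ρB ∧
      hilbertSchmidtLoss (dephaseProd ħ μA μB) (opTensor ρA ρB) =
        purity ρA * purity ρB - purity (dephase ħ μA ρA) * purity (dephase ħ μB ρB)) ∧
    ((∃ ξ, ‖dephasingFun ħ μA ξ‖ < 1) → (∃ ξ, ‖dephasingFun ħ μB ξ‖ < 1) →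
      ∃ ρA ρB : L2R →L[ℂ] L2R, IsDensityOperator ρA ∧ IsDensityOperator ρB ∧
        hilbertSchmidtLoss (dephaseProd ħ μA μB) (opTensor ρA ρB) ≠
          hilbertSchmidtLoss (dephase ħ μA) ρA + hilbertSchmidtLoss (dephase ħ μB) ρB) := by
  refine ⟨fun ρA ρB hA hB => ⟨⟨hA.opTensor hB, hA.dephase, hB.dephase,
    dephaseProd_opTensor hA hB⟩, relEntropyLoss_dephaseProd_opTensor hA hB,
    hilbertSchmidtLoss_dephaseProd_opTensor hA hB⟩, fun hgA hgB => ?_⟩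
  obtain ⟨ψ, hnorm, hψ⟩ := exists_norm_eq_one_ae_ne_zero (volume : Measure ℝ)
  have hρ := isDensityOperator_rankOne_self hnorm
  have hA := purity_dephase_rankOne_ne_one hgA hnorm hψ
  have hB := purity_dephase_rankOne_ne_one hgB hnorm hψ
  refine ⟨_, _, hρ, hρ, fun h => ?_⟩
  rw [hilbertSchmidtLoss_dephaseProd_opTensor hρ hρ, hilbertSchmidtLoss, hilbertSchmidtLoss,
    purity_rankOne_self hnorm] at h
  exact mul_ne_zero (sub_ne_zero.mpr hA) (sub_ne_zero.mpr hB) (by linear_combination -h)
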